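/- Let $\Upsilon:\mathbb{R}^n\rightrightarrows\mathbb{R}^n$ be a set-valued mapping with closed graph $\operatorname{gph}\Upsilon=\{(x,y)\mid y\in\Upsilon(x)\}$, and let $0\in\Upsilon(\bar x)$. All vector norms are Euclidean, $\|M\|$ is the spectral norm and $\|M\|_F$ the Frobenius norm of a matrix $M$. Notation. For a set $S$ and $z\in S$, $\widehat N_S(z)=\{\eta\mid \eta^\top(w-z)\le o(\|w-z\|)\ \forall w\in S\}$ is the regular normal cone. The limiting normal cone $N_S(z)$ consists of all limits of sequences $\eta_k\in\widehat N_S(z_k)$ with $z_k\in S$, $z_k\to z$. The directional normal cone $N_S(z;u)$ consists of all limits of sequences $\eta_k\in\widehat N_S(z+t_ku_k)$ with $t_k\downarrow0$, $u_k\to u$, $z+t_ku_k\in S$. The mapping $\Upsilon$ is semismooth* at $(\bar x,0)$ if $\eta^\top u=0$ for all $u\in\mathbb{R}^{2n}$ and all $\eta\in N_{\operatorname{gph}\Upsilon}((\bar x,0);u)$. For $(x,y)\in\operatorname{gph}\Upsilon$, let $\mathcal{A}_{\rm reg}\Upsilon(x,y)$ be the set of all pairs $(A,B)$ of real $n\times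 n$ matrices with $A$ invertible such that, for each $i=1,\dots,n$, the $i$-th rows $(x_i^*)^\top$ of $A$ and $(y_i^*)^\top$ of $B$ satisfy $(x_i^*,-y_i^*)\in N_{\operatorname{gph}\Upsilon}(x,y)$ (i.e. $x_i^*\in D^*\Upsilon(x,y)(y_i^*)$ for the limiting coderivative $D^*$). For $L,C\ge0$ and $x\in\mathbb{R}^n$, let $$\mathcal{G}^{L,C}(x)=\left\{((\hat x,\hat y),(A,B))\ \middle|\ (\hat x,\hat y)\in\operatorname{gph}\Upsilon,\ (A,B)\in\mathcal{A}_{\rm reg}\Upsilon(\hat x,\hat y),\ \|(\hat x-\bar x,\hat y)\|\le L\|x-\bar x\|,\ \|A^{-1}\|\,\|[A\,|\,B]\|_F\le C\right\}.$$ The semismooth* Newton method with choices from $\mathcal{G}^{L,C}$ starts at $x_0$ and, as long as $0\notin\Upsilon(x_k)$, chooses $((\hat x_k,\hat y_k),(A_k,B_k))\in\mathcal{G}^{L,C}(x_k)$ and sets $x_{k+1}:=\hat x_k-A_k^{-1}B_k\hat y_k$; it stops at $x_k$ if $0\in\Upsilon(x_k)$. Strong metric subregularity of $\Upsilon$ at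 $(x,y)\in\operatorname{gph}\Upsilon$ with constant $c>0$ means that $\operatorname{dist}(x',\Upsilon^{-1}(y))\le c\operatorname{dist}(y,\Upsilon(x'))$ for all $x'$ near $x$ (with $\operatorname{dist}(\cdot,\emptyset)=\infty$) and that $x$ is an isolated point of $\Upsilon^{-1}(y)$. The mapping $\Upsilon$ is strongly metrically subregular around $(\bar x,0)$ with constant $c$ if it is strongly metrically subregular with constant $c$ at all points of $\operatorname{gph}\Upsilon$ in some neighborhood of $(\bar x,0)$; the infimum of all such $c$ is the modulus. Theorem. (i) Suppose that $\Upsilon$ is semismooth* at $(\bar x,0)$ and that there are $L,C>0$ with $\mathcal{G}^{L,C}(x)\ne\emptyset$ for all $x$ sufficiently close to $\bar x$ with $0\notin\Upsilon(x)$. Then there is $\delta>0$ such that, for every $x_0$ with $\|x_0-\bar x\|\le\delta$ and however the choices from $\mathcal{G}^{L,C}$ are made, the semismooth* Newton method with choices from $\mathcal{G}^{L,C}$ never gets stuck (i.e. $\mathcal{G}^{L,C}(x_k)\neq\emptyset$ whenever $0\notin\Upsilon(x_k)$), and it either stops after finitely many iterations at a solution of $0\in\Upsilon(x)$, or produces an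 infinite sequence with $x_k\to\bar x$ and $\|x_{k+1}-\bar x\|=o(\|x_k-\bar x\|)$. (ii) If $\Upsilon$ is strongly metrically subregular around $(\bar x,0)$ with modulus $\kappa$, then for every $\beta\ge1$ one has $\mathcal{G}^{L,C}(x)\ne\emptyset$ with $L=\beta+1$ and $C=\sqrt{n(1+\kappa^2)}$ for all $x$ sufficiently close to $\bar x$ with $0\notin\Upsilon(x)$. -/

import Mathlib

open Filter Topology

namespace SemismoothStar

noncomputable section

/-! ### Normal cones -/

section NormalCones

variable {V : Type*} [NormedAddCommGroup V] [InnerProductSpace ℝ V]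

/-- The regular (Fréchet) normal cone to `S` at `z`: all `η` such that
`⟪η, w - z⟫ ≤ o(‖w - z‖)` for `w ∈ S`. It is empty if `z ∉ S`. -/
def regularNormalCone (S : Set V) (z : V) : Set V :=
  {η | z ∈ S ∧ ∀ ε : ℝ, 0 < ε → ∀ᶠ w in 𝓝[S] z, inner ℝ η (w - z) ≤ ε * ‖w - z‖}

/-- The limiting (Mordukhovich) normal cone to `S` at `z`. -/
def limitingNormalCone (S : Set V) (z : V) : Set V :=
  {η | ∃ (zs ηs : ℕ → V), Tendsto zs atTop (𝓝 z) ∧ Tendsto ηs atTop (𝓝 η) ∧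
    ∀ k, ηs k ∈ regularNormalCone S (zs k)}

/-- The directional limiting normal cone to `S` at `z` in direction `u`. -/
def directionalNormalCone (S : Set V) (z u : V) : Set V :=
  {η | ∃ (t : ℕ → ℝ) (us ηs : ℕ → V), (∀ k, 0 < t k) ∧ Tendsto t atTop (𝓝 0) ∧
    Tendsto us atTop (𝓝 u) ∧ Tendsto ηs atTop (𝓝 η) ∧
    ∀ k, ηs k ∈ regularNormalCone S (z + t k • us k)}

/-- A set `S` is semismooth* at `z` if every directional limiting normal in any direction `u`
is orthogonal to `u`. -/
def IsSemismoothStarSet (S : Set V) (z : V) : Prop :=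
  ∀ u : V, ∀ η ∈ directionalNormalCone S z u, inner ℝ η u = 0

end NormalCones

/-! ### Set-valued mappings between Euclidean spaces -/

section SetValued

variable {n m : ℕ}

/-- The point `(x, y)` of `ℝⁿ × ℝᵐ`, where the product carries the Euclidean norm. -/
abbrev pair (x : EuclideanSpace ℝ (Fin n)) (y : EuclideanSpace ℝ (Fin m)) :
    WithLp 2 (EuclideanSpace ℝ (Fin n) × EuclideanSpace ℝ (Fin m)) :=
  WithLp.toLp 2 (x, y)

/-- The graph of a set-valued mapping `F : ℝⁿ ⇉ ℝᵐ`. -/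
def gph (F : EuclideanSpace ℝ (Fin n) → Set (EuclideanSpace ℝ (Fin m))) :
    Set (WithLp 2 (EuclideanSpace ℝ (Fin n) × EuclideanSpace ℝ (Fin m))) :=
  {z | z.snd ∈ F z.fst}

/-- The limiting coderivative `D*F(x, y) : ℝᵐ ⇉ ℝⁿ`. -/
def coderivative (F : EuclideanSpace ℝ (Fin n) → Set (EuclideanSpace ℝ (Fin m)))
    (x : EuclideanSpace ℝ (Fin n)) (y : EuclideanSpace ℝ (Fin m))
    (ystar : EuclideanSpace ℝ (Fin m)) : Set (EuclideanSpace ℝ (Fin n)) :=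
  {xstar | pair xstar (-ystar) ∈ limitingNormalCone (gph F) (pair x y)}

/-- `F` is semismooth* at `(x, y)` if its graph is. -/
def IsSemismoothStarAt (F : EuclideanSpace ℝ (Fin n) → Set (EuclideanSpace ℝ (Fin m)))
    (x : EuclideanSpace ℝ (Fin n)) (y : EuclideanSpace ℝ (Fin m)) : Prop :=
  IsSemismoothStarSet (gph F) (pair x y)

/-- `F` is metrically subregular at `(x, y)` with constant `κ`. Distances take values in `[0, ∞]`,
the distance to the empty set being `∞`. -/
def IsMetricallySubregularAt (F : EuclideanSpace ℝ (Fin n) → Set (EuclideanSpace ℝ (Fin m)))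
    (x : EuclideanSpace ℝ (Fin n)) (y : EuclideanSpace ℝ (Fin m)) (κ : ℝ) : Prop :=
  ∀ᶠ x' in 𝓝 x, Metric.infEDist x' {w | y ∈ F w} ≤ ENNReal.ofReal κ * Metric.infEDist y (F x')

/-- `F` is strongly metrically subregular at the graph point `(x, y)` with constant `κ`:
additionally, `x` is an isolated point of `F⁻¹(y)`. -/
def IsStronglySubregularAt (F : EuclideanSpace ℝ (Fin n) → Set (EuclideanSpace ℝ (Fin m)))
    (x : EuclideanSpace ℝ (Fin n)) (y : EuclideanSpace ℝ (Fin m)) (κ : ℝ) : Prop :=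
  y ∈ F x ∧ IsMetricallySubregularAt F x y κ ∧ ∀ᶠ x' in 𝓝 x, y ∈ F x' → x' = x

/-- `F` is strongly metrically subregular around `(x, y)` with constant `κ`. -/
def IsStronglySubregularAround (F : EuclideanSpace ℝ (Fin n) → Set (EuclideanSpace ℝ (Fin m)))
    (x : EuclideanSpace ℝ (Fin n)) (y : EuclideanSpace ℝ (Fin m)) (κ : ℝ) : Prop :=
  ∀ᶠ z in 𝓝 (pair x y), z ∈ gph F → IsStronglySubregularAt F z.fst z.snd κ

/-- `F` is strongly metrically subregular around `(x, y)` (with some constant), and `κ` is the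
modulus of this property, i.e. the infimum of all constants. -/
def HasStrongSubregularityModulusAround
    (F : EuclideanSpace ℝ (Fin n) → Set (EuclideanSpace ℝ (Fin m)))
    (x : EuclideanSpace ℝ (Fin n)) (y : EuclideanSpace ℝ (Fin m)) (κ : ℝ) : Prop :=
  {c : ℝ | 0 < c ∧ IsStronglySubregularAround F x y c}.Nonempty ∧
    IsGLB {c : ℝ | 0 < c ∧ IsStronglySubregularAround F x y c} κ

end SetValued

/-! ### The semismooth* Newton method -/

section Method

/-- The Frobenius norm of a matrix. -/
def frobeniusNorm {m n : Type*} [Fintype m] [Fintype n] (M : Matrix m n ℝ) : ℝ :=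
  letI : NormedAddCommGroup (Matrix m n ℝ) := Matrix.frobeniusNormedAddCommGroup
  ‖M‖

/-- The spectral norm of a square matrix, i.e. the operator norm for the Euclidean norm. -/
def spectralNorm {n : ℕ} (M : Matrix (Fin n) (Fin n) ℝ) : ℝ :=
  ‖Matrix.toEuclideanCLM (n := Fin n) (𝕜 := ℝ) M‖

variable {n : ℕ}

/-- All pairs `(A, B)` whose `i`-th rows `x*ᵢ` and `y*ᵢ` satisfy `x*ᵢ ∈ D*F(x, y)(y*ᵢ)`,
for all `i`. -/
def coderivativeMatrices (F : EuclideanSpace ℝ (Fin n) → Set (EuclideanSpace ℝ (Fin n)))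
    (x y : EuclideanSpace ℝ (Fin n)) :
    Set (Matrix (Fin n) (Fin n) ℝ × Matrix (Fin n) (Fin n) ℝ) :=
  {P | ∀ i : Fin n, WithLp.toLp 2 (P.1.row i) ∈ coderivative F x y (WithLp.toLp 2 (P.2.row i))}

/-- The pairs `(A, B)` in `coderivativeMatrices F x y` with `A` invertible. -/
def regularCoderivativeMatrices (F : EuclideanSpace ℝ (Fin n) → Set (EuclideanSpace ℝ (Fin n)))
    (x y : EuclideanSpace ℝ (Fin n)) :
    Set (Matrix (Fin n) (Fin n) ℝ × Matrix (Fin n) (Fin n) ℝ) :=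
  {P | P ∈ coderivativeMatrices F x y ∧ IsUnit P.1}

/-- The data `((x̂, ŷ), (A, B))` chosen in one iteration. -/
structure NewtonChoice (n : ℕ) where
  xhat : EuclideanSpace ℝ (Fin n)
  yhat : EuclideanSpace ℝ (Fin n)
  A : Matrix (Fin n) (Fin n) ℝ
  B : Matrix (Fin n) (Fin n) ℝ

/-- The new iterate `x̂ - A⁻¹ B ŷ`. -/
def NewtonChoice.next (q : NewtonChoice n) : EuclideanSpace ℝ (Fin n) :=
  q.xhat - Matrix.toEuclideanCLM (n := Fin n) (𝕜 := ℝ) (q.A⁻¹ * q.B) q.yhat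

/-- The set of admissible choices at `x`, for the constants `L` and `C` and the
reference point `xbar`. -/
def admissibleChoices (F : EuclideanSpace ℝ (Fin n) → Set (EuclideanSpace ℝ (Fin n)))
    (xbar : EuclideanSpace ℝ (Fin n)) (L C : ℝ) (x : EuclideanSpace ℝ (Fin n)) :
    Set (NewtonChoice n) :=
  {q | q.yhat ∈ F q.xhat ∧ (q.A, q.B) ∈ regularCoderivativeMatrices F q.xhat q.yhat ∧
    ‖pair (q.xhat - xbar) q.yhat‖ ≤ L * ‖x - xbar‖ ∧
    spectralNorm q.A⁻¹ * frobeniusNorm (Matrix.fromCols q.A q.B) ≤ C}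

/-- A complete execution of the semismooth* Newton method performing `N ∈ {0, 1, …, ∞}` iterations,
with iterates `x k` (for `k ≤ N`) and choices `q k` (for `k < N`) all taken from the admissible
sets. The loop is entered exactly at nonsolutions. An execution that performs
finitely many iterations ends because the last iterate is a solution, or because it is stuck:
there is no admissible choice. -/
structure IsExecution (F : EuclideanSpace ℝ (Fin n) → Set (EuclideanSpace ℝ (Fin n)))
    (xbar : EuclideanSpace ℝ (Fin n)) (L C : ℝ)
    (x : ℕ → EuclideanSpace ℝ (Fin n)) (q : ℕ → NewtonChoice n) (N : ℕ∞) : Prop where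
  nonsolution : ∀ k : ℕ, (k : ℕ∞) < N → 0 ∉ F (x k)
  choice : ∀ k : ℕ, (k : ℕ∞) < N → q k ∈ admissibleChoices F xbar L C (x k)
  step : ∀ k : ℕ, (k : ℕ∞) < N → x (k + 1) = (q k).next
  complete : ∀ k : ℕ, (k : ℕ∞) = N → 0 ∈ F (x k) ∨ admissibleChoices F xbar L C (x k) = ∅

/-- Superlinear convergence of `x` to `xbar`: `x k → xbar` and
`‖x (k + 1) - xbar‖ = o(‖x k - xbar‖)`. -/
def ConvergesSuperlinearly (x : ℕ → EuclideanSpace ℝ (Fin n))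
    (xbar : EuclideanSpace ℝ (Fin n)) : Prop :=
  Tendsto x atTop (𝓝 xbar) ∧
    (fun k => x (k + 1) - xbar) =o[atTop] (fun k => x k - xbar)

end Method

end

end SemismoothStar

/-!
Convergence and feasibility of the semismooth* Newton method.

*Convergence.* If `gph F` is semismooth* at `(xbar, 0)`, a compactness argument gives
`|⟪η, w - (xbar, 0)⟫| ≤ ε ‖η‖ ‖w - (xbar, 0)‖` for all limiting normals `η` at graph points `w` close
to `(xbar, 0)` (`IsSemismoothStarSet.abs_inner_le`). The error of the new iterate is
`A⁻¹ (A (x̂ - xbar) - B ŷ)`, and the `i`-th entry of the vector in parentheses is the inner product of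
a normal, formed by the `i`-th rows of `A` and `B`, with `(x̂, ŷ) - (xbar, 0)`. Hence the new error is
at most `ε ‖A⁻¹‖ ‖[A | B]‖_F ‖(x̂, ŷ) - (xbar, 0)‖ ≤ ε C L ‖x - xbar‖`
(`IsSemismoothStarAt.norm_next_sub_le`), which gives superlinear convergence and keeps the iterates
where admissible choices exist.

*Feasibility.* Strong subregularity at `(xbar, 0)` with constant `c` means `‖x - xbar‖ ≤ c ‖y‖` for
graph points `(x, y)` with `x` close to `xbar`. For `‖xstar‖ ≤ 1` the point `(xbar, 0)` therefore
minimizes `-⟪xstar, x - xbar⟫ + c ‖y‖` locally over the graph, and a smoothed Fermat rule produces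
`ystar` with `‖ystar‖ ≤ c` and `xstar ∈ D*F(xbar, 0)(ystar)`. Because the limiting normal cone is
stable under limits of regular normals, the infimum `κ` of the constants can replace `c`
(`HasStrongSubregularityModulusAround.exists_mem_coderivative`). With the unit vectors as `xstar`,
the choice `(x̂, ŷ) = (xbar, 0)`, `A = 1` is admissible, and `‖[1 | B]‖_F² ≤ n (1 + κ²)`.
-/

namespace SemismoothStar

/-! ### Regular normals and the uniform form of semismoothness* -/

section NormalCones

variable {V : Type*} [NormedAddCommGroup V] [InnerProductSpace ℝ V] {S : Set V} {z η : V}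

theorem smul_mem_regularNormalCone (hη : η ∈ regularNormalCone S z) {a : ℝ} (ha : 0 < a) :
    a • η ∈ regularNormalCone S z := by
  refine ⟨hη.1, fun ε hε => ?_⟩
  filter_upwards [hη.2 (ε / a) (by positivity)] with w hw
  rw [real_inner_smul_left]
  calc a * inner ℝ η (w - z) ≤ a * (ε / a * ‖w - z‖) := by gcongr
    _ = ε * ‖w - z‖ := by field_simp

/-- Proximal normals are regular normals. -/
theorem mem_regularNormalCone_of_inner_le_sq (hz : z ∈ S) {K : ℝ}
    (h : ∀ᶠ w in 𝓝[S] z, inner ℝ η (w - z) ≤ K * ‖w - z‖ ^ 2) :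
    η ∈ regularNormalCone S z := by
  refine ⟨hz, fun ε hε => ?_⟩
  have hlim : Tendsto (fun w => K * ‖w - z‖) (𝓝[S] z) (𝓝 0) := by
    have : Continuous fun w : V => K * ‖w - z‖ := by fun_prop
    simpa using (this.tendsto z).mono_left nhdsWithin_le_nhds
  filter_upwards [h, hlim.eventually_lt_const hε] with w hw hwε
  calc inner ℝ η (w - z) ≤ K * ‖w - z‖ * ‖w - z‖ := by rw [mul_assoc, ← sq]; exact hw
    _ ≤ ε * ‖w - z‖ := by gcongr

/-- At a semismooth* point, regular normals at nearby points `w` are almost orthogonal to `w - z`,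
uniformly in `w`: otherwise, the normalized normals and secant directions would accumulate at a
directional limiting normal which is not orthogonal to its direction. -/
theorem IsSemismoothStarSet.abs_inner_le_of_mem_regularNormalCone [ProperSpace V]
    (hS : IsSemismoothStarSet S z) {ε : ℝ} (hε : 0 < ε) :
    ∃ δ > 0, ∀ w ∈ Metric.ball z δ, ∀ η ∈ regularNormalCone S w,
      |inner ℝ η (w - z)| ≤ ε * ‖η‖ * ‖w - z‖ := by
  by_contra! hcon
  choose w hw η hη hlt using fun k : ℕ => hcon (1 / ((k : ℝ) + 1)) (by positivity)
  have hη0 (k : ℕ) : 0 < ‖η k‖ := by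
    rw [norm_pos_iff]
    intro h
    simpa [h] using hlt k
  have hw0 (k : ℕ) : 0 < ‖w k - z‖ := by
    rw [norm_pos_iff]
    intro h
    simpa [h] using hlt k
  obtain ⟨⟨u, ξ⟩, -, φ, hφ, hlim⟩ :=
    ((isCompact_sphere (0 : V) 1).prod (isCompact_sphere (0 : V) 1)).tendsto_subseq
      (x := fun k => (‖w k - z‖⁻¹ • (w k - z), ‖η k‖⁻¹ • η k)) fun k => by
        constructor <;>
          simp [norm_smul, (hη0 k).ne', (hw0 k).ne']
  have hlim1 : Tendsto (fun k => ‖w (φ k) - z‖⁻¹ • (w (φ k) - z)) atTop (𝓝 u) :=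
    (continuous_fst.tendsto _).comp hlim
  have hlim2 : Tendsto (fun k => ‖η (φ k)‖⁻¹ • η (φ k)) atTop (𝓝 ξ) :=
    (continuous_snd.tendsto _).comp hlim
  have ht : Tendsto (fun k => ‖w k - z‖) atTop (𝓝 0) :=
    squeeze_zero (fun _ => norm_nonneg _)
      (fun k => by simpa [dist_eq_norm] using (Metric.mem_ball.1 (hw k)).le)
      tendsto_one_div_add_atTop_nhds_zero_nat
  have hzero : inner ℝ ξ u = 0 := by
    refine hS u ξ ⟨fun k => ‖w (φ k) - z‖, _, _, fun k => hw0 _, ht.comp hφ.tendsto_atTop,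
      hlim1, hlim2, fun k => ?_⟩
    rw [smul_inv_smul₀ (hw0 _).ne', add_sub_cancel]
    exact smul_mem_regularNormalCone (hη _) (inv_pos.2 (hη0 _))
  have hge : ε ≤ |inner ℝ ξ u| := by
    refine ge_of_tendsto (hlim2.inner hlim1).abs (Eventually.of_forall fun k => ?_)
    have h1 := hη0 (φ k)
    have h2 := hw0 (φ k)
    rw [real_inner_smul_left, real_inner_smul_right, abs_mul, abs_mul, abs_of_pos (inv_pos.2 h1),
      abs_of_pos (inv_pos.2 h2), ← mul_assoc, ← mul_inv, inv_mul_eq_div, le_div_iff₀ (by positivity)]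
    linarith [hlt (φ k)]
  rw [hzero, abs_zero] at hge
  linarith

/-- The uniform estimate for limiting normals, which are limits of regular normals at nearby
points. -/
theorem IsSemismoothStarSet.abs_inner_le [ProperSpace V]
    (hS : IsSemismoothStarSet S z) {ε : ℝ} (hε : 0 < ε) :
    ∃ δ > 0, ∀ w ∈ Metric.ball z δ, ∀ η ∈ limitingNormalCone S w,
      |inner ℝ η (w - z)| ≤ ε * ‖η‖ * ‖w - z‖ := by
  obtain ⟨δ, hδ, h⟩ := hS.abs_inner_le_of_mem_regularNormalCone hε
  refine ⟨δ, hδ, ?_⟩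
  rintro w hw η ⟨ws, ηs, hws, hηs, hmem⟩
  have hsub : Tendsto (fun k => ws k - z) atTop (𝓝 (w - z)) := hws.sub_const z
  refine le_of_tendsto_of_tendsto (hηs.inner hsub).abs ((hηs.norm.const_mul ε).mul hsub.norm) ?_
  filter_upwards [hws.eventually (Metric.isOpen_ball.mem_nhds hw)] with k hk
  exact h _ hk _ (hmem k)

end NormalCones

/-! ### Local superlinear convergence -/

section Newton

variable {n : ℕ}

theorem frobeniusNorm_nonneg {m n : Type*} [Fintype m] [Fintype n] (M : Matrix m n ℝ) :
    0 ≤ frobeniusNorm M :=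
  letI : NormedAddCommGroup (Matrix m n ℝ) := Matrix.frobeniusNormedAddCommGroup
  norm_nonneg M

theorem frobeniusNorm_sq {m n : Type*} [Fintype m] [Fintype n] (M : Matrix m n ℝ) :
    frobeniusNorm M ^ 2 = ∑ i, ∑ j, M i j ^ 2 := by
  rw [frobeniusNorm, Matrix.frobenius_norm_def, ← Real.sqrt_eq_rpow, Real.sq_sqrt (by positivity)]
  simp

/-- The squared Frobenius norm of `[A | B]` as a sum over the coderivative pairs formed by the
rows; the sign of the second component is the one in the definition of the coderivative. -/
theorem frobeniusNorm_fromCols_sq (A B : Matrix (Fin n) (Fin n) ℝ) :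
    frobeniusNorm (Matrix.fromCols A B) ^ 2 =
      ∑ i, ‖pair (WithLp.toLp 2 (A.row i)) (-WithLp.toLp 2 (B.row i))‖ ^ 2 := by
  rw [frobeniusNorm_sq]
  refine Finset.sum_congr rfl fun i _ => ?_
  rw [WithLp.prod_norm_sq_eq_of_L2]
  simp [EuclideanSpace.real_norm_sq_eq, Matrix.row]

/-- One step of the method contracts the distance to `xbar` by an arbitrarily small factor near
`xbar`: the error of the new iterate is `A⁻¹` applied to `A (x̂ - xbar) - B ŷ`, whose entries are
inner products of graph normals with `(x̂, ŷ) - (xbar, 0)`. -/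
theorem IsSemismoothStarAt.norm_next_sub_le
    {F : EuclideanSpace ℝ (Fin n) → Set (EuclideanSpace ℝ (Fin n))}
    {xbar : EuclideanSpace ℝ (Fin n)} (hF : IsSemismoothStarAt F xbar 0) {L C : ℝ}
    (hL : 0 < L) (hC : 0 < C) {ε : ℝ} (hε : 0 < ε) :
    ∃ δ > 0, ∀ x, ‖x - xbar‖ < δ → ∀ q ∈ admissibleChoices F xbar L C x,
      ‖q.next - xbar‖ ≤ ε * ‖x - xbar‖ := by
  obtain ⟨δ, hδ, h⟩ := IsSemismoothStarSet.abs_inner_le hF (ε := ε / (C * L)) (by positivity)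
  refine ⟨δ / L, by positivity, ?_⟩
  rintro x hx ⟨xh, yh, A, B⟩ ⟨-, ⟨hAB, hA⟩, hR, hcond⟩
  dsimp only at hAB hA hR hcond
  have hpair : pair xh yh - pair xbar 0 = pair (xh - xbar) yh := by
    rw [← WithLp.toLp_sub, Prod.mk_sub_mk, sub_zero]
  have hball : pair xh yh ∈ Metric.ball (pair xbar (0 : EuclideanSpace ℝ (Fin n))) δ := by
    rw [mem_ball_iff_norm, hpair]
    exact hR.trans_lt (by rwa [lt_div_iff₀' hL] at hx)
  set R := ‖x - xbar‖
  set v : EuclideanSpace ℝ (Fin n) :=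
    Matrix.toEuclideanCLM (n := Fin n) (𝕜 := ℝ) A (xh - xbar) -
      Matrix.toEuclideanCLM (n := Fin n) (𝕜 := ℝ) B yh with hv
  have hnext : NewtonChoice.next ⟨xh, yh, A, B⟩ - xbar =
      Matrix.toEuclideanCLM (n := Fin n) (𝕜 := ℝ) A⁻¹ v := by
    have h1 : Matrix.toEuclideanCLM (n := Fin n) (𝕜 := ℝ) A⁻¹
        (Matrix.toEuclideanCLM (n := Fin n) (𝕜 := ℝ) A (xh - xbar)) = xh - xbar := by
      rw [← mul_apply_eq_comp, ← map_mul,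
        Matrix.nonsing_inv_mul _ ((Matrix.isUnit_iff_isUnit_det _).1 hA), map_one,
        one_apply_eq_self]
    rw [hv, map_sub, h1, NewtonChoice.next, map_mul, mul_apply_eq_comp]
    abel
  have hentry (i : Fin n) : v i ^ 2 ≤ (ε / (C * L) * (L * R)) ^ 2 *
      ‖pair (WithLp.toLp 2 (A.row i)) (-WithLp.toLp 2 (B.row i))‖ ^ 2 := by
    have hvi : v i = inner ℝ (pair (WithLp.toLp 2 (A.row i)) (-WithLp.toLp 2 (B.row i)))
        (pair xh yh - pair xbar 0) := by
      rw [hpair, WithLp.prod_inner_apply, hv]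
      simp [Matrix.mulVec, dotProduct, PiLp.inner_apply, sub_eq_add_neg, mul_add,
        Finset.sum_add_distrib, Matrix.row, mul_comm]
    rw [← mul_pow, ← sq_abs (v i)]
    refine pow_le_pow_left₀ (abs_nonneg _) ?_ 2
    rw [hvi]
    refine (h _ hball _ (hAB i)).trans ?_
    rw [hpair, mul_right_comm]
    gcongr
  have hvnorm : ‖v‖ ≤ ε / (C * L) * (L * R) * frobeniusNorm (Matrix.fromCols A B) := by
    refine le_of_sq_le_sq ?_ (mul_nonneg (by positivity) (frobeniusNorm_nonneg _))
    rw [mul_pow, frobeniusNorm_fromCols_sq, EuclideanSpace.real_norm_sq_eq, Finset.mul_sum]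
    exact Finset.sum_le_sum fun i _ => hentry i
  calc ‖NewtonChoice.next ⟨xh, yh, A, B⟩ - xbar‖ ≤ spectralNorm A⁻¹ * ‖v‖ := by
        rw [hnext]; exact ContinuousLinearMap.le_opNorm _ _
    _ ≤ spectralNorm A⁻¹ * (ε / (C * L) * (L * R) * frobeniusNorm (Matrix.fromCols A B)) :=
        mul_le_mul_of_nonneg_left hvnorm (norm_nonneg _)
    _ = ε / (C * L) * (L * R) *
        (spectralNorm A⁻¹ * frobeniusNorm (Matrix.fromCols A B)) := by ring
    _ ≤ ε / (C * L) * (L * R) * C := by gcongr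
    _ = ε * R := by field_simp

/-- The contraction factor `1 / 2` keeps the iterates in the region where admissible choices exist
and makes an infinite run converge; arbitrarily small factors near `xbar` then make the convergence
superlinear. -/
theorem IsSemismoothStarAt.exists_radius_of_convergence
    {F : EuclideanSpace ℝ (Fin n) → Set (EuclideanSpace ℝ (Fin n))}
    {xbar : EuclideanSpace ℝ (Fin n)} (hF : IsSemismoothStarAt F xbar 0) {L C : ℝ}
    (hL : 0 < L) (hC : 0 < C)
    (hne : ∀ᶠ x in 𝓝 xbar, 0 ∉ F x → (admissibleChoices F xbar L C x).Nonempty) :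
    ∃ δ : ℝ, 0 < δ ∧ ∀ (x : ℕ → EuclideanSpace ℝ (Fin n)) (q : ℕ → NewtonChoice n) (N : ℕ∞),
      x 0 ∈ Metric.closedBall xbar δ → IsExecution F xbar L C x q N →
      (∃ k : ℕ, (k : ℕ∞) = N ∧ 0 ∈ F (x k)) ∨ (N = ⊤ ∧ ConvergesSuperlinearly x xbar) := by
  obtain ⟨δ₁, hδ₁, hstep⟩ := hF.norm_next_sub_le hL hC (ε := 1 / 2) (by norm_num)
  obtain ⟨δ₂, hδ₂, hne'⟩ := Metric.eventually_nhds_iff_ball.1 hne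
  refine ⟨min δ₁ δ₂ / 2, by positivity, fun x q N hx0 hex => ?_⟩
  have hx0' : ‖x 0 - xbar‖ < min δ₁ δ₂ :=
    (mem_closedBall_iff_norm.1 hx0).trans_lt (half_lt_self (by positivity))
  have hgeom (k : ℕ) (hk : (k : ℕ∞) ≤ N) : ‖x k - xbar‖ ≤ (1 / 2) ^ k * ‖x 0 - xbar‖ := by
    induction k with
    | zero => simp
    | succ k ih =>
      have hkN : (k : ℕ∞) < N := lt_of_lt_of_le (by exact_mod_cast k.lt_succ_self) hk
      have hi := ih hkN.le
      have hlt : ‖x k - xbar‖ < δ₁ :=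
        (hi.trans (mul_le_of_le_one_left (norm_nonneg _)
          (pow_le_one₀ (by norm_num) (by norm_num)))).trans_lt (hx0'.trans_le (min_le_left _ _))
      rw [hex.step k hkN, pow_succ']
      linarith [hstep _ hlt _ (hex.choice k hkN)]
  cases N with
  | coe k =>
    have hlt : ‖x k - xbar‖ < δ₂ :=
      ((hgeom k le_rfl).trans (mul_le_of_le_one_left (norm_nonneg _)
        (pow_le_one₀ (by norm_num) (by norm_num)))).trans_lt (hx0'.trans_le (min_le_right _ _))
    refine Or.inl ⟨k, rfl, ?_⟩
    by_contra hmem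
    exact (hne' _ (mem_ball_iff_norm.2 hlt) hmem).ne_empty
      ((hex.complete k rfl).resolve_left hmem)
  | top =>
    refine Or.inr ⟨rfl, ?_⟩
    have htend : Tendsto x atTop (𝓝 xbar) := by
      rw [tendsto_iff_norm_sub_tendsto_zero]
      refine squeeze_zero (fun _ => norm_nonneg _) (fun k => hgeom k le_top) ?_
      simpa using (tendsto_pow_atTop_nhds_zero_of_lt_one (r := (1 / 2 : ℝ))
        (by norm_num) (by norm_num)).mul_const ‖x 0 - xbar‖
    refine ⟨htend, Asymptotics.isLittleO_iff.2 fun ε hε => ?_⟩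
    obtain ⟨δ, hδ, h⟩ := hF.norm_next_sub_le hL hC hε
    filter_upwards [(tendsto_iff_norm_sub_tendsto_zero.1 htend).eventually_lt_const hδ] with k hk
    rw [hex.step k (WithTop.coe_lt_top k)]
    exact h _ hk _ (hex.choice k (WithTop.coe_lt_top k))

end Newton

/-! ### Strong metric subregularity and coderivatives -/

section Subregularity

variable {n m : ℕ} {F : EuclideanSpace ℝ (Fin n) → Set (EuclideanSpace ℝ (Fin m))}
  {xbar : EuclideanSpace ℝ (Fin n)}

theorem IsStronglySubregularAt.norm_sub_le {c : ℝ} (hF : IsStronglySubregularAt F xbar 0 c)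
    (hc : 0 ≤ c) :
    ∃ r > 0, ∀ x y, y ∈ F x → ‖x - xbar‖ < r → ‖x - xbar‖ ≤ c * ‖y‖ := by
  obtain ⟨-, hsub, hiso⟩ := hF
  obtain ⟨r₁, hr₁, hsub⟩ := Metric.eventually_nhds_iff_ball.1 hsub
  obtain ⟨r₂, hr₂, hiso⟩ := Metric.eventually_nhds_iff_ball.1 hiso
  refine ⟨min r₁ (r₂ / 2), by positivity, fun x y hy hx => ?_⟩
  -- Within half the isolation radius, `xbar` is the point of `F⁻¹(0)` nearest to `x`.
  have hdist : ENNReal.ofReal ‖x - xbar‖ ≤ Metric.infEDist x {w | 0 ∈ F w} := by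
    refine Metric.le_infEDist.2 fun w hw => ?_
    rw [edist_dist]
    refine ENNReal.ofReal_le_ofReal ?_
    rw [← dist_eq_norm]
    by_cases hwr : dist w xbar < r₂
    · rw [hiso w (Metric.mem_ball.2 hwr) hw]
    · have h1 : dist x xbar < r₂ / 2 := by
        rw [dist_eq_norm]; exact hx.trans_le (min_le_right _ _)
      have h2 := dist_triangle w x xbar
      rw [dist_comm w x] at h2
      linarith
  have hy' : Metric.infEDist 0 (F x) ≤ ENNReal.ofReal ‖y‖ := by
    refine (Metric.infEDist_le_edist_of_mem hy).trans_eq ?_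
    rw [edist_dist, dist_zero_left]
  have hle := (hdist.trans (hsub x (mem_ball_iff_norm.2 (hx.trans_le (min_le_left _ _))))).trans
    (mul_le_mul_right hy' _)
  rwa [← ENNReal.ofReal_mul hc, ENNReal.ofReal_le_ofReal_iff (by positivity)] at hle

/-- Near `(xbar, 0)` the graph has regular normals whose first component is almost `xstar` and whose
second component has norm at most about `c`. Subregularity makes `(xbar, 0)` a minimizer of
`-⟪xstar, x - xbar⟫ + c ‖y‖` over the graph near `(xbar, 0)`. After smoothing `‖y‖` to
`√(‖y‖² + δ²)` and adding a quadratic which localizes the minimizers, the negative gradient at a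
minimizer is a proximal normal. -/
theorem IsStronglySubregularAt.exists_regularNormal (hclosed : IsClosed (gph F)) {c : ℝ}
    (hF : IsStronglySubregularAt F xbar 0 c) (hc : 0 ≤ c)
    {xstar : EuclideanSpace ℝ (Fin n)} (hx : ‖xstar‖ ≤ 1) {ε : ℝ} (hε : 0 < ε) :
    ∃ z, ∃ η ∈ regularNormalCone (gph F) z, ‖z - pair xbar 0‖ ≤ ε ∧
      ‖η.fst - xstar‖ ≤ ε ∧ ‖η.snd‖ ≤ c + ε := by
  obtain ⟨r, hr, hle⟩ := hF.norm_sub_le hc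
  set zbar := pair xbar (0 : EuclideanSpace ℝ (Fin m)) with hzbar
  obtain ⟨ρ, hρ, hρr, hρε⟩ : ∃ ρ > 0, ρ < r ∧ 2 * ρ ≤ ε :=
    ⟨min (r / 2) (ε / 2), by positivity, (min_le_left _ _).trans_lt (half_lt_self hr),
      by linarith [min_le_right (r / 2) (ε / 2)]⟩
  -- The minimizer will satisfy `‖z - zbar‖ ^ 2 ≤ c * δ`, hence lie in the open ball of radius `ρ`.
  obtain ⟨δ, hδ, hcδ⟩ : ∃ δ > 0, c * δ < ρ ^ 2 := by
    refine ⟨ρ ^ 2 / (c + 1), by positivity, ?_⟩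
    rw [mul_div_assoc', div_lt_iff₀ (by positivity)]
    nlinarith [sq_pos_of_pos hρ]
  have hnorm (z) : ‖z - zbar‖ ^ 2 = ‖z.fst - xbar‖ ^ 2 + ‖z.snd‖ ^ 2 := by
    rw [WithLp.prod_norm_sq_eq_of_L2]
    simp [hzbar]
  have hfst (z) : ‖z.fst - xbar‖ ≤ ‖z - zbar‖ :=
    le_of_sq_le_sq (by rw [hnorm]; linarith [sq_nonneg ‖z.snd‖]) (norm_nonneg _)
  have hsnd (z) : ‖z.snd‖ ≤ ‖z - zbar‖ :=
    le_of_sq_le_sq (by rw [hnorm]; linarith [sq_nonneg ‖z.fst - xbar‖]) (norm_nonneg _)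
  let φ : WithLp 2 (EuclideanSpace ℝ (Fin n) × EuclideanSpace ℝ (Fin m)) → ℝ := fun z =>
    -inner ℝ xstar (z.fst - xbar) + c * √(‖z.snd‖ ^ 2 + δ ^ 2) + ‖z - zbar‖ ^ 2
  have hφcont : Continuous φ := by
    have h1 : Continuous fun z : WithLp 2 (EuclideanSpace ℝ (Fin n) × EuclideanSpace ℝ (Fin m)) =>
        z.fst := continuous_fst.comp (WithLp.prod_continuous_ofLp 2 _ _)
    have h2 : Continuous fun z : WithLp 2 (EuclideanSpace ℝ (Fin n) × EuclideanSpace ℝ (Fin m)) =>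
        z.snd := continuous_snd.comp (WithLp.prod_continuous_ofLp 2 _ _)
    fun_prop
  have hmem : zbar ∈ gph F ∩ Metric.closedBall zbar ρ :=
    ⟨hF.1, Metric.mem_closedBall_self hρ.le⟩
  obtain ⟨z, ⟨hzF, hzρ⟩, hmin⟩ :=
    ((isCompact_closedBall zbar ρ).inter_left hclosed).exists_isMinOn ⟨_, hmem⟩ hφcont.continuousOn
  have hφz : ‖z - zbar‖ ^ 2 ≤ φ z := by
    have h1 : inner ℝ xstar (z.fst - xbar) ≤ ‖z.fst - xbar‖ :=
      (real_inner_le_norm _ _).trans (mul_le_of_le_one_left (norm_nonneg _) hx)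
    have h2 : ‖z.fst - xbar‖ ≤ c * ‖z.snd‖ :=
      hle _ _ hzF (((hfst z).trans (mem_closedBall_iff_norm.1 hzρ)).trans_lt hρr)
    have h3 : c * ‖z.snd‖ ≤ c * √(‖z.snd‖ ^ 2 + δ ^ 2) :=
      mul_le_mul_of_nonneg_left (Real.le_sqrt_of_sq_le (by linarith [sq_nonneg δ])) hc
    simp only [φ]
    linarith
  have hφbar : φ zbar = c * δ := by
    simp [φ, hzbar, Real.sqrt_sq hδ.le]
  have hzlt : ‖z - zbar‖ < ρ :=
    lt_of_pow_lt_pow_left₀ 2 hρ.le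
      ((hφz.trans ((hmin hmem).trans_eq hφbar)).trans_lt hcδ)
  set a := √(‖z.snd‖ ^ 2 + δ ^ 2) with ha
  have hapos : 0 < a := Real.sqrt_pos.2 (by positivity)
  have hasq : a ^ 2 = ‖z.snd‖ ^ 2 + δ ^ 2 := Real.sq_sqrt (by positivity)
  have hza : ‖z.snd‖ ≤ a := Real.le_sqrt_of_sq_le (by linarith [sq_nonneg δ])
  refine ⟨z, pair (xstar - (2 : ℝ) • (z.fst - xbar)) (-(c / a + 2) • z.snd), ?_, ?_, ?_, ?_⟩
  · refine mem_regularNormalCone_of_inner_le_sq hzF (K := 1 + c / (2 * a)) ?_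
    have hev : ∀ᶠ w in 𝓝[gph F] z, w ∈ gph F ∩ Metric.ball zbar ρ :=
      inter_mem self_mem_nhdsWithin
        (mem_nhdsWithin_of_mem_nhds (Metric.isOpen_ball.mem_nhds (mem_ball_iff_norm.2 hzlt)))
    filter_upwards [hev] with w hw
    have hφw : φ z ≤ φ w := hmin ⟨hw.1, Metric.ball_subset_closedBall hw.2⟩
    -- Concavity of the square root: its graph lies below its tangent.
    have hsqrt : √(‖w.snd‖ ^ 2 + δ ^ 2) - a ≤ (‖w.snd‖ ^ 2 - ‖z.snd‖ ^ 2) / (2 * a) := by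
      rw [le_div_iff₀ (by positivity)]
      have hb : √(‖w.snd‖ ^ 2 + δ ^ 2) ^ 2 = ‖w.snd‖ ^ 2 + δ ^ 2 := Real.sq_sqrt (by positivity)
      nlinarith [sq_nonneg (√(‖w.snd‖ ^ 2 + δ ^ 2) - a)]
    have hexp2 : ‖w.snd‖ ^ 2 - ‖z.snd‖ ^ 2 =
        2 * inner ℝ z.snd (w.snd - z.snd) + ‖w.snd - z.snd‖ ^ 2 := by
      have := norm_add_sq_real z.snd (w.snd - z.snd)
      rw [add_sub_cancel] at this
      linarith
    have hexp1 : ‖w.fst - xbar‖ ^ 2 - ‖z.fst - xbar‖ ^ 2 =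
        2 * inner ℝ (z.fst - xbar) (w.fst - z.fst) + ‖w.fst - z.fst‖ ^ 2 := by
      have := norm_add_sq_real (z.fst - xbar) (w.fst - z.fst)
      rw [show z.fst - xbar + (w.fst - z.fst) = w.fst - xbar by abel] at this
      linarith
    have hwz : ‖w - z‖ ^ 2 = ‖w.fst - z.fst‖ ^ 2 + ‖w.snd - z.snd‖ ^ 2 := by
      rw [WithLp.prod_norm_sq_eq_of_L2]; simp
    have hlin : inner ℝ xstar (w.fst - xbar) - inner ℝ xstar (z.fst - xbar) =
        inner ℝ xstar (w.fst - z.fst) := by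
      rw [← inner_sub_right]; congr 1; abel
    have hη : inner ℝ (pair (xstar - (2 : ℝ) • (z.fst - xbar)) (-(c / a + 2) • z.snd)) (w - z) =
        inner ℝ xstar (w.fst - z.fst) - 2 * inner ℝ (z.fst - xbar) (w.fst - z.fst) -
          (c / a + 2) * inner ℝ z.snd (w.snd - z.snd) := by
      rw [WithLp.prod_inner_apply]
      change inner ℝ (xstar - (2 : ℝ) • (z.fst - xbar)) (w.fst - z.fst) +
        inner ℝ (-(c / a + 2) • z.snd) (w.snd - z.snd) = _
      rw [inner_sub_left, real_inner_smul_left, real_inner_smul_left]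
      ring
    have hcs : c * (√(‖w.snd‖ ^ 2 + δ ^ 2) - a) ≤
        c / a * inner ℝ z.snd (w.snd - z.snd) + c / (2 * a) * ‖w.snd - z.snd‖ ^ 2 := by
      refine (mul_le_mul_of_nonneg_left hsqrt hc).trans_eq ?_
      rw [hexp2]
      field_simp
    have hrest : 0 ≤ c / (2 * a) * ‖w.fst - z.fst‖ ^ 2 := by positivity
    simp only [φ, hnorm] at hφw
    rw [hη, hwz]
    linarith
  · linarith
  · change ‖xstar - (2 : ℝ) • (z.fst - xbar) - xstar‖ ≤ ε
    rw [sub_sub_cancel_left, norm_neg, norm_smul, Real.norm_two]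
    linarith [hfst z]
  · change ‖-(c / a + 2) • z.snd‖ ≤ c + ε
    rw [norm_smul, norm_neg, Real.norm_of_nonneg (by positivity), add_mul]
    have : c / a * ‖z.snd‖ ≤ c := by
      rw [div_mul_eq_mul_div, div_le_iff₀ hapos]
      gcongr
    linarith [hsnd z]

/-- Every vector `xstar` of the unit ball belongs to `D*F(xbar, 0)(ystar)` for some `ystar` no longer
than the modulus of strong subregularity. -/
theorem HasStrongSubregularityModulusAround.exists_mem_coderivative (hclosed : IsClosed (gph F))
    (hsol : 0 ∈ F xbar) {κ : ℝ} (hF : HasStrongSubregularityModulusAround F xbar 0 κ)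
    {xstar : EuclideanSpace ℝ (Fin n)} (hx : ‖xstar‖ ≤ 1) :
    ∃ ystar, ‖ystar‖ ≤ κ ∧ xstar ∈ coderivative F xbar 0 ystar := by
  have hpos (k : ℕ) : (0 : ℝ) < 1 / ((k : ℝ) + 1) := by positivity
  have hstep (k : ℕ) : ∃ z, ∃ η ∈ regularNormalCone (gph F) z,
      ‖z - pair xbar 0‖ ≤ 1 / ((k : ℝ) + 1) ∧ ‖η.fst - xstar‖ ≤ 1 / ((k : ℝ) + 1) ∧
        ‖η.snd‖ ≤ κ + 1 / ((k : ℝ) + 1) + 1 / ((k : ℝ) + 1) := by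
    obtain ⟨c, ⟨hc0, hc⟩, -, hck⟩ := hF.2.exists_between (lt_add_of_pos_right κ (hpos k))
    have hat : IsStronglySubregularAt F xbar 0 c := hc.self_of_nhds hsol
    obtain ⟨z, η, hη, h1, h2, h3⟩ := hat.exists_regularNormal hclosed hc0.le hx (hpos k)
    exact ⟨z, η, hη, h1, h2, by linarith⟩
  choose z η hη hz hfst hsnd using hstep
  have hlim := tendsto_one_div_add_atTop_nhds_zero_nat (𝕜 := ℝ)
  obtain ⟨y, -, φ, hφ, hy⟩ := (isCompact_closedBall (0 : EuclideanSpace ℝ (Fin m))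
    (κ + 1 + 1)).tendsto_subseq (x := fun k => (η k).snd) fun k => by
      have : 1 / ((k : ℝ) + 1) ≤ 1 := by
        rw [div_le_one (by positivity)]
        linarith [k.cast_nonneg (α := ℝ)]
      rw [mem_closedBall_zero_iff]
      linarith [hsnd k]
  have hz' : Tendsto z atTop (𝓝 (pair xbar 0)) :=
    tendsto_iff_norm_sub_tendsto_zero.2 (squeeze_zero (fun _ => norm_nonneg _) hz hlim)
  have hx' : Tendsto (fun k => (η k).fst) atTop (𝓝 xstar) :=
    tendsto_iff_norm_sub_tendsto_zero.2 (squeeze_zero (fun _ => norm_nonneg _) hfst hlim)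
  refine ⟨-y, ?_, z ∘ φ, η ∘ φ, hz'.comp hφ.tendsto_atTop, ?_, fun k => hη _⟩
  · rw [norm_neg]
    have hb : Tendsto (fun k : ℕ => κ + 1 / ((k : ℝ) + 1) + 1 / ((k : ℝ) + 1)) atTop (𝓝 κ) := by
      simpa using (hlim.const_add κ).add hlim
    exact le_of_tendsto_of_tendsto' hy.norm (hb.comp hφ.tendsto_atTop) fun k => hsnd _
  · rw [neg_neg]
    exact ((WithLp.prod_continuous_toLp 2 _ _).tendsto (xstar, y)).comp
      ((hx'.comp hφ.tendsto_atTop).prodMk_nhds hy)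

end Subregularity

/-! ### Existence of admissible choices -/

section Existence

variable {n : ℕ}

/-- The reference point `(xbar, 0)` itself, with `A = 1` and the rows of `B` taken from
`exists_mem_coderivative`, is an admissible choice everywhere. -/
theorem HasStrongSubregularityModulusAround.admissibleChoices_nonempty
    {F : EuclideanSpace ℝ (Fin n) → Set (EuclideanSpace ℝ (Fin n))}
    (hclosed : IsClosed (gph F)) {xbar : EuclideanSpace ℝ (Fin n)} (hsol : 0 ∈ F xbar) {κ : ℝ}
    (hF : HasStrongSubregularityModulusAround F xbar 0 κ) {L : ℝ} (hL : 0 ≤ L)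
    (x : EuclideanSpace ℝ (Fin n)) :
    (admissibleChoices F xbar L (√(n * (1 + κ ^ 2))) x).Nonempty := by
  have hrow (i : Fin n) :
      ‖(WithLp.toLp 2 ((1 : Matrix (Fin n) (Fin n) ℝ).row i) : EuclideanSpace ℝ (Fin n))‖ = 1 := by
    rw [← sq_eq_sq₀ (norm_nonneg _) zero_le_one, EuclideanSpace.real_norm_sq_eq]
    simp [Matrix.row, Matrix.one_apply]
  choose b hbκ hb using fun i => hF.exists_mem_coderivative hclosed hsol (hrow i).le
  refine ⟨⟨xbar, 0, 1, Matrix.of fun i => (b i).ofLp⟩, hsol, ⟨fun i => hb i, isUnit_one⟩, ?_, ?_⟩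
  · have h0 : pair (xbar - xbar) (0 : EuclideanSpace ℝ (Fin n)) = 0 := by
      rw [sub_self]; rfl
    rw [h0, norm_zero]
    positivity
  · have hspec : spectralNorm (1 : Matrix (Fin n) (Fin n) ℝ)⁻¹ ≤ 1 := by
      rw [spectralNorm, inv_one, map_one]
      exact ContinuousLinearMap.norm_id_le
    refine (mul_le_of_le_one_left (frobeniusNorm_nonneg _) hspec).trans ?_
    refine Real.le_sqrt_of_sq_le ?_
    rw [frobeniusNorm_fromCols_sq]
    refine (Finset.sum_le_card_nsmul _ _ (1 + κ ^ 2) fun i _ => ?_).trans_eq (by simp [mul_add])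
    rw [WithLp.prod_norm_sq_eq_of_L2]
    change ‖WithLp.toLp 2 ((1 : Matrix (Fin n) (Fin n) ℝ).row i)‖ ^ 2 + ‖-b i‖ ^ 2 ≤ 1 + κ ^ 2
    rw [hrow, norm_neg, one_pow]
    have := hbκ i
    gcongr

end Existence

end SemismoothStar

theorem mainTheorem3 (n : ℕ)
    (F : EuclideanSpace ℝ (Fin n) → Set (EuclideanSpace ℝ (Fin n)))
    (hclosed : IsClosed (SemismoothStar.gph F))
    (xbar : EuclideanSpace ℝ (Fin n)) (hsol : 0 ∈ F xbar) :
    (SemismoothStar.IsSemismoothStarAt F xbar 0 →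
      ∀ L C : ℝ, 0 < L → 0 < C →
        (∀ᶠ x in 𝓝 xbar, 0 ∉ F x →
          (SemismoothStar.admissibleChoices F xbar L C x).Nonempty) →
        ∃ δ : ℝ, 0 < δ ∧
          ∀ (x : ℕ → EuclideanSpace ℝ (Fin n)) (q : ℕ → SemismoothStar.NewtonChoice n) (N : ℕ∞),
            x 0 ∈ Metric.closedBall xbar δ →
            SemismoothStar.IsExecution F xbar L C x q N →
            (∃ k : ℕ, (k : ℕ∞) = N ∧ 0 ∈ F (x k)) ∨
              (N = ⊤ ∧ SemismoothStar.ConvergesSuperlinearly x xbar)) ∧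
    (∀ κ : ℝ, SemismoothStar.HasStrongSubregularityModulusAround F xbar 0 κ →
      ∀ β : ℝ, 1 ≤ β →
        ∀ᶠ x in 𝓝 xbar, 0 ∉ F x →
          (SemismoothStar.admissibleChoices F xbar (β + 1) (√(n * (1 + κ ^ 2))) x).Nonempty) := by
  refine ⟨fun hF L C hL hC hne => hF.exists_radius_of_convergence hL hC hne,
    fun κ hκ β hβ => Eventually.of_forall fun x _ => ?_⟩
  exact hκ.admissibleChoices_nonempty hclosed hsol (by linarith) x
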